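/- Let $\mathbb{C}_2$ be the completion of an algebraic closure $\overline{\mathbb{Q}}_2$ of $\mathbb{Q}_2$, and let $E\subset\overline{\mathbb{Q}}_2$ be a finite extension of $\mathbb{Q}_2$. Let $D\subset\mathbb{C}_2$ be a disk, that is, a set of the form $\{x : |x-a|\le r\}$ or $\{x : |x-a|<r\}$ with $a\in\mathbb{C}_2$ and $r\in\mathbb{R}$. Suppose that $D$ is defined over $E$, that is, invariant under the action of the absolute Galois group $G_E=\operatorname{Gal}(\overline{\mathbb{Q}}_2/E)$ on $\mathbb{C}_2$ (extended from $\overline{\mathbb{Q}}_2$ by continuity). Let $e$ be the smallest integer such that there exists a finite extension $F\subset\overline{\mathbb{Q}}_2$ of $E$ with ramification index $e_{F/E}=e$ and $F\cap D\neq\emptyset$; such an $e$ exists as soon as $D$ has more than one point. Then $e=2^s$ for some integer $s\ge 0$, and there exists a totally ramified finite extension $F\subset\overline{\mathbb{Q}}_2$ of $E$ with $[F:E]=2^s$ and $F\cap D\neq\emptyset$. -/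

import Mathlib

open scoped NNReal

namespace PadicDisk

variable {p : ℕ} [Fact p.Prime]

/-- The `p`-adic valuation on a field `K` equipped with an embedding in the algebraic closure
of `ℚ_[p]`. -/
noncomputable def val (p : ℕ) [Fact p.Prime] (K : Type*) [Field K] [Algebra K (PadicAlgCl p)] :
    Valuation K ℝ≥0 :=
  (Valued.v : Valuation (PadicAlgCl p) ℝ≥0).comap (algebraMap K (PadicAlgCl p))

/-- The ring of integers of `K`, the set of `x` in `K` such that `|x| ≤ 1`. -/
noncomputable abbrev integers (p : ℕ) [Fact p.Prime] (K : Type*) [Field K]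
    [Algebra K (PadicAlgCl p)] : ValuationSubring K :=
  (val p K).valuationSubring

instance val_hasExtension (K L : Type*) [Field K] [Field L] [Algebra K (PadicAlgCl p)]
    [Algebra L (PadicAlgCl p)] [Algebra K L] [IsScalarTower K L (PadicAlgCl p)] :
    (val p K).HasExtension (val p L) where
  val_isEquiv_comap := by
    have h : val p K = (val p L).comap (algebraMap K L) := by
      ext x
      simp [val, Valuation.comap_apply, ← IsScalarTower.algebraMap_apply]
    exact h ▸ Valuation.IsEquiv.refl

/-- The ramification index of `F` over `E`, the exponent with which the maximal ideal of the ring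
of integers of `F` occurs in the extension of the maximal ideal of the ring of integers of `E`. -/
noncomputable def ramificationIndex (E : IntermediateField ℚ_[p] (PadicAlgCl p))
    (F : IntermediateField E (PadicAlgCl p)) : ℕ :=
  (IsLocalRing.maximalIdeal (integers p E)).ramificationIdx'
    (IsLocalRing.maximalIdeal (integers p F))

/-- A finite extension `F` of `E` is totally ramified if its ramification index over `E` is equal
to its degree. -/
def IsTotallyRamified (E : IntermediateField ℚ_[p] (PadicAlgCl p))
    (F : IntermediateField E (PadicAlgCl p)) : Prop :=
  FiniteDimensional E F ∧ ramificationIndex E F = Module.finrank E F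

theorem continuous_gal (E : IntermediateField ℚ_[p] (PadicAlgCl p))
    (σ : PadicAlgCl p ≃ₐ[E] PadicAlgCl p) :
    Continuous (σ : PadicAlgCl p →+* PadicAlgCl p) := by
  have h : ∀ x : PadicAlgCl p, ‖σ x‖ = ‖x‖ := fun x =>
    (spectralNorm_eq_of_equiv (σ.restrictScalars ℚ_[p]) x).symm
  exact (AddMonoidHomClass.isometry_of_norm (σ : PadicAlgCl p →+* PadicAlgCl p) h).continuous

/-- The action of an element of the absolute Galois group of `E` on `ℂ_[p]`, extended from the
algebraic closure by continuity. -/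
noncomputable def galAction (E : IntermediateField ℚ_[p] (PadicAlgCl p))
    (σ : PadicAlgCl p ≃ₐ[E] PadicAlgCl p) : ℂ_[p] →+* ℂ_[p] :=
  UniformSpace.Completion.mapRingHom (σ : PadicAlgCl p →+* PadicAlgCl p) (continuous_gal E σ)

/-- A disk of `ℂ_[p]`, closed or open. -/
def IsDisk (D : Set ℂ_[p]) : Prop :=
  ∃ (a : ℂ_[p]) (r : ℝ), D = {x | ‖x - a‖ ≤ r} ∨ D = {x | ‖x - a‖ < r}

/-- A subset of `ℂ_[p]` is defined over `E` if it is invariant by the absolute Galois group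
of `E`. -/
def IsDefinedOver (E : IntermediateField ℚ_[p] (PadicAlgCl p)) (D : Set ℂ_[p]) : Prop :=
  ∀ σ : PadicAlgCl p ≃ₐ[E] PadicAlgCl p, galAction E σ '' D = D

/-- The extension `F` of `E` has a point in `D`. -/
def Meets (E : IntermediateField ℚ_[p] (PadicAlgCl p))
    (F : IntermediateField E (PadicAlgCl p)) (D : Set ℂ_[p]) : Prop :=
  ∃ x : PadicAlgCl p, x ∈ F ∧ (x : ℂ_[p]) ∈ D

/-- The set of the ramification indices over `E` of the finite extensions of `E` that have a
point in `D`. -/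
def ramificationIndices (E : IntermediateField ℚ_[p] (PadicAlgCl p)) (D : Set ℂ_[p]) : Set ℕ :=
  {e | ∃ F : IntermediateField E (PadicAlgCl p),
    FiniteDimensional E F ∧ ramificationIndex E F = e ∧ Meets E F D}

end PadicDisk

/-! Degrees can be lowered without leaving the disk, for every prime `p`. Let `x ∈ F ∩ D`, and let
`r` be the largest distance from `x` to its conjugates over `E`; then `D` contains the closed disk
of radius `r` around `x`. Suppose `L/K` is finite with an integral `α` of trace one, and `f` is the
minimal polynomial of `x` over `L`, of degree `n`. Applying `Tr(α ·)` to the coefficients of `f`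
gives a monic `g` over `K` of degree `n`. The roots of the conjugates of `f` are conjugates of `x`,
so `|g(x)| ≤ r ^ n` and `g` has a root within `r` of `x`
(`exists_norm_sub_le_natDegree_minpoly_le`). This is used twice. Let `U = E(z) ⊂ F` be the
unramified part, with `[F : U] ≤ e(F/E)`. Over `U`, taking for `L` the fixed field of a Sylow
`p`-subgroup and `α = 1/[L : U]` lowers the degree to a power `p ^ t ≤ [F : U]`. Then `U` itself has
an integral element of trace one over `E`, which yields `w ∈ D` of degree at most `p ^ t` over `E`.
If `e = e(F/E)` is minimal, then `e ≤ e(E(w)/E) ≤ [E(w) : E] ≤ p ^ t ≤ e`, and all are equal. -/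

/-! ### Lowering degrees by weighted traces of polynomials -/

theorem Multiset.norm_prod_map_sub_le {Ω : Type*} [NormedField Ω] {x : Ω} {r : ℝ}
    (s : Multiset Ω) (h : ∀ z ∈ s, ‖x - z‖ ≤ r) : ‖(s.map (fun z => x - z)).prod‖ ≤ r ^ s.card := by
  induction s using Multiset.induction with
  | empty => simp
  | cons a s ih =>
    rw [map_cons, prod_cons, norm_mul, card_cons, pow_succ']
    have ha := h a (mem_cons_self a s)
    exact mul_le_mul ha (ih fun z hz => h z (mem_cons_of_mem hz)) (norm_nonneg _)
      ((norm_nonneg _).trans ha)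

theorem Multiset.exists_norm_sub_le_of_norm_prod_map_sub_le {Ω : Type*} [NormedField Ω] {x : Ω}
    {r : ℝ} (hr : 0 ≤ r) {s : Multiset Ω} (hs : s ≠ 0)
    (h : ‖(s.map (fun z => x - z)).prod‖ ≤ r ^ s.card) : ∃ z ∈ s, ‖x - z‖ ≤ r := by
  induction s using Multiset.induction with
  | empty => exact absurd rfl hs
  | cons a s ih =>
    by_contra! hlt
    have ha := hlt a (mem_cons_self a s)
    rcases eq_or_ne s 0 with rfl | hs'
    · simp at h
      exact absurd h (not_le.mpr ha)
    · refine absurd (ih hs' ?_) (by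
        rintro ⟨z, hz, hzr⟩
        exact absurd hzr (not_le.mpr (hlt z (mem_cons_of_mem hz))))
      rw [map_cons, prod_cons, norm_mul, card_cons, pow_succ'] at h
      by_contra! hlt'
      exact absurd h (not_le.mpr (mul_lt_mul'' ha hlt' hr (pow_nonneg hr _)))

-- `|g(x)|` is the product of the distances from `x` to the roots of `g`, so they cannot all exceed
-- `r`.
open Polynomial in
theorem exists_aeval_eq_zero_norm_sub_le {K Ω : Type*} [Field K] [NormedField Ω] [IsAlgClosed Ω]
    [Algebra K Ω] {g : K[X]} (hg : g.Monic) (hd : g.natDegree ≠ 0) {x : Ω} {r : ℝ} (hr : 0 ≤ r)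
    (h : ‖aeval x g‖ ≤ r ^ g.natDegree) : ∃ y : Ω, aeval y g = 0 ∧ ‖y - x‖ ≤ r := by
  have hsplit : (g.map (algebraMap K Ω)).Splits := IsAlgClosed.splits _
  have hcard : (g.aroots Ω).card = g.natDegree := by
    rw [aroots_def, ← hsplit.natDegree_eq_card_roots, natDegree_map]
  have hprod : aeval x g = ((g.aroots Ω).map (fun z => x - z)).prod := by
    rw [hsplit.aeval_eq_prod_aroots, hg.leadingCoeff, map_one, one_mul]
  rw [hprod, ← hcard] at h
  obtain ⟨z, hz, hzr⟩ := Multiset.exists_norm_sub_le_of_norm_prod_map_sub_le hr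
    (by rw [← Multiset.card_pos, hcard]; exact Nat.pos_of_ne_zero hd) h
  exact ⟨z, (mem_aroots.mp hz).2, by rwa [norm_sub_rev]⟩

open Polynomial in
/-- Every conjugate over `L` of a point is a conjugate over `K`, also after twisting by a
`K`-embedding of `L`. -/
theorem exists_algEquiv_eq_of_eval_map_minpoly_eq_zero {K L Ω : Type*} [Field K] [Field L] [Field Ω]
    [IsAlgClosed Ω] [Algebra K L] [Algebra K Ω] [Algebra L Ω] [IsScalarTower K L Ω]
    [Algebra.IsAlgebraic K Ω] (τ : L →ₐ[K] Ω) {x w : Ω}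
    (h : ((minpoly L x).map (τ : L →+* Ω)).eval w = 0) : ∃ σ : Ω ≃ₐ[K] Ω, σ x = w := by
  have : IsAlgClosure K Ω := ⟨inferInstance, inferInstance⟩
  have : Normal K Ω := IsAlgClosure.normal K Ω
  refine minpoly.exists_algEquiv_of_root' (Algebra.IsAlgebraic.isAlgebraic x) ?_
  obtain ⟨q, hq⟩ := minpoly.dvd_map_of_isScalarTower K L x
  have h' := congrArg (fun f => (f.map (τ : L →+* Ω)).eval w) hq
  simp only [Polynomial.map_mul, eval_mul, h, zero_mul, Polynomial.map_map] at h'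
  rw [← h', AlgHom.comp_algebraMap, eval_map_algebraMap]

open Polynomial in
/-- Averaging the conjugates of the minimal polynomial over `L` of a point `x`, with weights the
conjugates of an integral element of trace one, gives a polynomial over `K` with a root close
to `x`. -/
theorem exists_norm_sub_le_natDegree_minpoly_le {K L Ω : Type*} [Field K] [Field L] [NormedField Ω]
    [IsUltrametricDist Ω] [IsAlgClosed Ω] [Algebra K L] [Algebra K Ω] [Algebra L Ω]
    [IsScalarTower K L Ω] [Algebra.IsAlgebraic K Ω] [FiniteDimensional K L]
    [Algebra.IsSeparable K L] (hK : ∀ (σ : Ω ≃ₐ[K] Ω) (z : Ω), ‖σ z‖ = ‖z‖) {α : L}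
    (hα : ‖algebraMap L Ω α‖ ≤ 1) (htr : Algebra.trace K L α = 1) {x : Ω} {r : ℝ}
    (hr : ∀ σ : Ω ≃ₐ[K] Ω, ‖σ x - x‖ ≤ r) :
    ∃ y : Ω, ‖y - x‖ ≤ r ∧ (minpoly K y).natDegree ≤ (minpoly L x).natDegree := by
  have hr0 : 0 ≤ r := by simpa using hr AlgEquiv.refl
  have hxK : IsIntegral K x := (Algebra.IsAlgebraic.isAlgebraic x).isIntegral
  have hxL : IsIntegral L x := hxK.tower_top
  set f := minpoly L x
  have hf : f.Monic := minpoly.monic hxL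
  let g : K[X] := ∑ i ∈ Finset.range (f.natDegree + 1), monomial i (Algebra.trace K L (α * f.coeff i))
  have hgc : ∀ i, g.coeff i = Algebra.trace K L (α * f.coeff i) := fun i => by
    simp only [g, finsetSum_coeff, coeff_monomial, Finset.sum_ite_eq', Finset.mem_range]
    split_ifs with h
    · rfl
    · rw [coeff_eq_zero_of_natDegree_lt (by omega), mul_zero, map_zero]
  have hgdeg : g.natDegree ≤ f.natDegree := natDegree_le_iff_coeff_eq_zero.mpr fun i hi => by
    rw [hgc, coeff_eq_zero_of_natDegree_lt hi, mul_zero, map_zero]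
  -- Trace one is exactly what keeps the leading coefficient equal to 1.
  have hg1 : g.coeff f.natDegree = 1 := by rw [hgc, hf.coeff_natDegree, mul_one, htr]
  have hgm : g.Monic := monic_of_natDegree_le_of_coeff_eq_one _ hgdeg hg1
  have hgn : g.natDegree = f.natDegree :=
    natDegree_eq_of_le_of_coeff_ne_zero hgdeg (by rw [hg1]; exact one_ne_zero)
  have hmap : g.map (algebraMap K Ω) =
      ∑ τ : L →ₐ[K] Ω, C (τ α) * f.map (τ : L →+* Ω) := by
    ext i
    simp [hgc, trace_eq_sum_embeddings (E := Ω), coeff_map]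
  have hle : ‖aeval x g‖ ≤ r ^ g.natDegree := by
    rw [← eval_map_algebraMap, hmap, eval_finsetSum, hgn]
    refine IsUltrametricDist.norm_sum_le_of_forall_le_of_nonneg (pow_nonneg hr0 _) fun τ _ => ?_
    rw [eval_mul, eval_C, norm_mul]
    have hτ : ‖τ α‖ ≤ 1 := by
      -- Over `L` the minimal polynomial of `α` is `X - α`, so `τ α` is a conjugate of `α` over `K`.
      obtain ⟨σ, hσ⟩ := exists_algEquiv_eq_of_eval_map_minpoly_eq_zero (K := K) τ
        (x := algebraMap L Ω α) (w := τ α) (by simp [minpoly.eq_X_sub_C])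
      rwa [← hσ, hK]
    have hev : ‖(f.map (τ : L →+* Ω)).eval x‖ ≤ r ^ f.natDegree := by
      have hs : (f.map (τ : L →+* Ω)).Splits := IsAlgClosed.splits _
      rw [hs.eval_eq_prod_roots_of_monic (hf.map _), ← hf.natDegree_map (τ : L →+* Ω),
        hs.natDegree_eq_card_roots]
      refine Multiset.norm_prod_map_sub_le _ fun z hz => ?_
      obtain ⟨σ, rfl⟩ := exists_algEquiv_eq_of_eval_map_minpoly_eq_zero τ (x := x)
        (isRoot_of_mem_roots hz)
      rw [norm_sub_rev]
      exact hr σ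
    simpa using mul_le_mul hτ hev (norm_nonneg _) zero_le_one
  obtain ⟨y, hy, hyx⟩ := exists_aeval_eq_zero_norm_sub_le hgm
    (hgn ▸ (minpoly.natDegree_pos hxL).ne') hr0 hle
  exact ⟨y, hyx, hgn ▸ natDegree_le_of_dvd (minpoly.dvd K y hy) hgm.ne_zero⟩

open IntermediateField in
/-- In an invariant disk around `x`, there is a point whose degree is at most the degree of `x`
over the fixed field of a Sylow subgroup. -/
theorem exists_norm_sub_le_natDegree_minpoly_le_prime_pow {K Ω : Type*} [Field K] [CharZero K]
    [NormedField Ω] [IsUltrametricDist Ω] [IsAlgClosed Ω] [Algebra K Ω] [Algebra.IsAlgebraic K Ω]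
    (hK : ∀ (σ : Ω ≃ₐ[K] Ω) (z : Ω), ‖σ z‖ = ‖z‖) (p : ℕ) [Fact p.Prime]
    (hp : ∀ m : ℕ, ¬ p ∣ m → ‖(m : Ω)‖ = 1) {x : Ω} {r : ℝ}
    (hr : ∀ σ : Ω ≃ₐ[K] Ω, ‖σ x - x‖ ≤ r) :
    ∃ (y : Ω) (t : ℕ), ‖y - x‖ ≤ r ∧ (minpoly K y).natDegree ≤ p ^ t ∧
      p ^ t ≤ (minpoly K x).natDegree := by
  have hx : IsIntegral K x := (Algebra.IsAlgebraic.isAlgebraic x).isIntegral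
  have : IsAlgClosure K Ω := ⟨inferInstance, inferInstance⟩
  have : Normal K Ω := IsAlgClosure.normal K Ω
  have : FiniteDimensional K K⟮x⟯ := adjoin.finiteDimensional hx
  let N : IntermediateField K Ω := normalClosure K K⟮x⟯ Ω
  have : Normal K N := normalClosure.normal K K⟮x⟯ Ω
  have : FiniteDimensional K N := normalClosure.is_finiteDimensional K K⟮x⟯ Ω
  have : IsGalois K N := {}
  obtain ⟨P⟩ : Nonempty (Sylow p Gal(N/K)) := inferInstance
  let L : IntermediateField K N := fixedField (P : Subgroup Gal(N/K))
  let xN : N := ⟨x, K⟮x⟯.le_normalClosure (mem_adjoin_simple_self K x)⟩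
  have hL : ¬ p ∣ Module.finrank K L := by
    rw [finrank_eq_fixingSubgroup_index, fixingSubgroup_fixedField]
    exact P.not_dvd_index
  -- This degree divides `[N : L]`, the order of the Sylow subgroup.
  obtain ⟨t, ht⟩ : ∃ t : ℕ, (minpoly L x).natDegree = p ^ t := by
    obtain ⟨k, hk⟩ := P.isPGroup'.exists_card_eq
    have hd : (minpoly L xN).natDegree ∣ p ^ k := by
      rw [← hk, ← finrank_fixedField_eq_card]
      exact minpoly.degree_dvd (IsIntegral.of_finite L xN)
    obtain ⟨t, -, ht⟩ := (Nat.dvd_prime_pow Fact.out).mp hd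
    exact ⟨t, by rw [← ht, ← minpoly.algebraMap_eq (algebraMap N Ω).injective xN]; rfl⟩
  have hm : (Module.finrank K L : K) ≠ 0 := by
    exact_mod_cast (Module.finrank_pos (R := K) (M := L)).ne'
  -- The weight `1/[L : K]` has norm one because `p` does not divide the Sylow index `[L : K]`.
  obtain ⟨y, hyx, hy⟩ := exists_norm_sub_le_natDegree_minpoly_le (L := L) hK
    (α := algebraMap K L (Module.finrank K L : K)⁻¹) (by simp [hp _ hL]) (by
      rw [Algebra.trace_algebraMap, nsmul_eq_mul, mul_inv_cancel₀ hm]) hr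
  refine ⟨y, t, hyx, ht ▸ hy, ht ▸ ?_⟩
  have h := Polynomial.natDegree_le_of_dvd (minpoly.dvd_map_of_isScalarTower K L x)
    ((minpoly.monic hx).map _).ne_zero
  rwa [Polynomial.natDegree_map] at h

/-! ### Rings of integers and the identity `ef = n` -/

namespace PadicDisk
variable {p : ℕ} [Fact p.Prime]

theorem mem_integers_iff {K : Type*} [Field K] [Algebra K (PadicAlgCl p)] {x : K} :
    x ∈ integers p K ↔ ‖algebraMap K (PadicAlgCl p) x‖ ≤ 1 :=
  Iff.rfl

theorem mem_maximalIdeal_integers_iff {K : Type*} [Field K] [Algebra K (PadicAlgCl p)]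
    {x : integers p K} :
    x ∈ IsLocalRing.maximalIdeal (integers p K) ↔ ‖algebraMap K (PadicAlgCl p) x‖ < 1 := by
  rw [ValuationSubring.valuation_lt_one_iff]
  exact (Valuation.isEquiv_valuation_valuationSubring (val p K)).symm.lt_one_iff_lt_one

theorem mem_integers_padic_iff {x : ℚ_[p]} : x ∈ integers p ℚ_[p] ↔ ‖x‖ ≤ 1 := by
  rw [mem_integers_iff, PadicAlgCl.norm_extends]

variable (p) in
/-- The integers of `ℚ_[p]` are the `p`-adic integers. -/
noncomputable def padicIntegersEquiv : integers p ℚ_[p] ≃+* ℤ_[p] where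
  toFun x := ⟨x, mem_integers_padic_iff.mp x.2⟩
  invFun x := ⟨x, mem_integers_padic_iff.mpr x.2⟩
  left_inv _ := rfl
  right_inv _ := rfl
  map_mul' _ _ := rfl
  map_add' _ _ := rfl

instance : IsPrincipalIdealRing (integers p ℚ_[p]) :=
  IsPrincipalIdealRing.of_surjective (padicIntegersEquiv p).symm.toRingHom
    (padicIntegersEquiv p).symm.surjective

instance : Finite (IsLocalRing.ResidueField (integers p ℚ_[p])) := by
  have : Finite (IsLocalRing.ResidueField ℤ_[p]) :=
    Finite.of_equiv _ (PadicInt.residueField (p := p)).symm.toEquiv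
  exact Finite.of_equiv _ (IsLocalRing.ResidueField.mapEquiv (padicIntegersEquiv p)).symm.toEquiv

theorem maximalIdeal_integers_ne_bot (p : ℕ) [Fact p.Prime] (K : Type*) [Field K]
    [Algebra K (PadicAlgCl p)] [Algebra ℚ_[p] K] :
    IsLocalRing.maximalIdeal (integers p K) ≠ ⊥ := by
  have hp : ‖(p : PadicAlgCl p)‖ < 1 := by
    rw [← map_natCast (algebraMap ℚ_[p] (PadicAlgCl p)), PadicAlgCl.norm_extends]
    exact Padic.norm_p_lt_one
  have hmem : (p : integers p K) ∈ IsLocalRing.maximalIdeal (integers p K) := by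
    rw [mem_maximalIdeal_integers_iff]
    simpa using hp
  intro h
  rw [h, Ideal.mem_bot] at hmem
  have : CharZero K := charZero_of_injective_algebraMap (algebraMap ℚ_[p] K).injective
  have h0 := congrArg (Subtype.val) hmem
  simp [(Fact.out : p.Prime).ne_zero] at h0

variable {K : Type*} [Field K] [Algebra K (PadicAlgCl p)] [Algebra ℚ_[p] K]
  [IsScalarTower ℚ_[p] K (PadicAlgCl p)]

open Polynomial in
theorem isIntegral_of_mem_integers [Algebra.IsAlgebraic ℚ_[p] K] {x : K} (hx : x ∈ integers p K) :
    IsIntegral (integers p ℚ_[p]) x := by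
  have hint : IsIntegral ℚ_[p] x := (Algebra.IsAlgebraic.isAlgebraic x).isIntegral
  have hm := minpoly.monic hint
  -- The norm on the algebraic closure is the spectral norm, read off these coefficients.
  have h1 : ∀ n, ‖(minpoly ℚ_[p] x).coeff n‖ ≤ 1 := by
    rw [← spectralValue_le_one_iff hm, ← minpoly.algebraMap_eq (algebraMap K (PadicAlgCl p)).injective]
    exact mem_integers_iff.mp hx
  have hl : minpoly ℚ_[p] x ∈ lifts (algebraMap (integers p ℚ_[p]) ℚ_[p]) := by
    rw [lifts_iff_coeff_lifts]
    exact fun n => ⟨⟨_, mem_integers_padic_iff.mpr (h1 n)⟩, rfl⟩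
  obtain ⟨q, hq, -, hqm⟩ := lifts_and_natDegree_eq_and_monic hl hm
  refine ⟨q, hqm, ?_⟩
  rw [← aeval_def, ← aeval_map_algebraMap ℚ_[p], hq, minpoly.aeval]

instance [Algebra.IsAlgebraic ℚ_[p] K] : IsIntegralClosure (integers p K) (integers p ℚ_[p]) K where
  algebraMap_injective := Subtype.val_injective
  isIntegral_iff {x} := by
    refine ⟨fun h => ?_, ?_⟩
    · exact IsIntegrallyClosed.algebraMap_eq_of_integral (R := integers p K) (h.tower_top (A := integers p K))
    · rintro ⟨y, rfl⟩
      exact isIntegral_of_mem_integers y.2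

variable [FiniteDimensional ℚ_[p] K]

instance : Module.Finite (integers p ℚ_[p]) (integers p K) :=
  IsIntegralClosure.finite (integers p ℚ_[p]) ℚ_[p] K (integers p K)

instance : IsDedekindDomain (integers p K) :=
  IsIntegralClosure.isDedekindDomain (integers p ℚ_[p]) ℚ_[p] K (integers p K)

instance : Finite (IsLocalRing.ResidueField (integers p K)) :=
  IsLocalRing.ResidueField.finite_of_finite (R := integers p ℚ_[p]) inferInstance

variable (E : IntermediateField ℚ_[p] (PadicAlgCl p)) [FiniteDimensional ℚ_[p] E]
  (F : IntermediateField E (PadicAlgCl p)) [FiniteDimensional E F]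

instance : FiniteDimensional ℚ_[p] F := FiniteDimensional.trans ℚ_[p] E F

instance : IsScalarTower ℚ_[p] F (PadicAlgCl p) := .of_algebraMap_eq fun _ => rfl

instance : IsScalarTower (integers p ℚ_[p]) (integers p E) (integers p F) :=
  .of_algebraMap_eq fun _ => rfl

instance : Module.Finite (integers p E) (integers p F) :=
  Module.Finite.of_restrictScalars_finite (integers p ℚ_[p]) (integers p E) (integers p F)

theorem ramificationIndex_mul_finrank_residueField :
    ramificationIndex E F * Module.finrank (IsLocalRing.ResidueField (integers p E))
      (IsLocalRing.ResidueField (integers p F)) = Module.finrank E F := by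
  rw [← Ideal.ramificationIdx_mul_inertiaDeg_of_isLocalRing (R := integers p E)
    (S := integers p F) E F (maximalIdeal_integers_ne_bot p E), Ideal.inertiaDeg'_algebraMap]
  rfl

theorem ramificationIndex_le_finrank : ramificationIndex E F ≤ Module.finrank E F := by
  rw [← ramificationIndex_mul_finrank_residueField]
  exact Nat.le_mul_of_pos_right _ Module.finrank_pos

end PadicDisk

/-! ### The unramified part and its integral element of trace one -/

-- Euler's formula: the trace-dual of the power basis consists of the coefficients of `minpoly / (X
-- - gen)` divided by the derivative at `gen`. The top coefficient is 1, and the last diagonal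
-- pairing gives the claim.
open Polynomial in
theorem PowerBasis.trace_gen_pow_div_aeval_derivative {K L : Type*} [Field K] [Field L]
    [Algebra K L] [FiniteDimensional K L] [Algebra.IsSeparable K L] (pb : PowerBasis K L) :
    Algebra.trace K L (pb.gen ^ (pb.dim - 1) / aeval pb.gen (derivative (minpoly K pb.gen))) = 1 := by
  have hint := Algebra.IsIntegral.isIntegral (R := K) pb.gen
  let i : Fin pb.dim := ⟨pb.dim - 1, Nat.sub_lt pb.dim_pos one_pos⟩
  have h := (Module.Basis.traceDual_eq_iff (b := pb.basis)).mp rfl i i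
  have hc : (minpolyDiv K pb.gen).coeff i = 1 := by
    have := minpolyDiv_monic hint
    rwa [Monic, leadingCoeff, natDegree_minpolyDiv, pb.natDegree_minpoly] at this
  rw [Module.Basis.traceDual_powerBasis_eq, hc, if_pos rfl, pb.basis_eq_pow, Algebra.traceForm_apply,
    one_div_mul_eq_div] at h
  exact h

-- By Taylor expansion, `0 = h(y) - h(x) = (y - x)(h'(x) + c(y - x))`, and the second factor is a
-- unit.
open Polynomial in
theorem IsLocalRing.eq_of_aeval_eq_zero_of_isUnit_derivative {R S : Type*} [CommRing R]
    [CommRing S] [IsLocalRing S] [Algebra R S] {h : R[X]} {x y : S} (hx : aeval x h = 0)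
    (hy : aeval y h = 0) (hd : IsUnit (aeval x (derivative h)))
    (hxy : y - x ∈ maximalIdeal S) : y = x := by
  obtain ⟨c, hc⟩ := (h.map (algebraMap R S)).binomExpansion x (y - x)
  rw [add_sub_cancel, derivative_map, eval_map_algebraMap, eval_map_algebraMap,
    eval_map_algebraMap, hx, hy, zero_add] at hc
  have hu : IsUnit (aeval x (derivative h) + c * (y - x)) := by
    by_contra hn
    refine (mem_maximalIdeal _).mp ?_ hd
    rw [← add_sub_cancel_right (aeval x (derivative h)) (c * (y - x))]
    exact sub_mem ((mem_maximalIdeal _).mpr hn) (Ideal.mul_mem_left _ _ hxy)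
  rw [← sub_eq_zero]
  refine hu.mul_right_eq_zero.mp ?_
  rw [hc]
  ring

namespace PadicDisk
variable {p : ℕ} [Fact p.Prime]

theorem norm_algEquiv {K : Type*} [Field K] [Algebra K (PadicAlgCl p)] [Algebra ℚ_[p] K]
    [IsScalarTower ℚ_[p] K (PadicAlgCl p)] (σ : PadicAlgCl p ≃ₐ[K] PadicAlgCl p)
    (x : PadicAlgCl p) : ‖σ x‖ = ‖x‖ :=
  (spectralNorm_eq_of_equiv (σ.restrictScalars ℚ_[p]) x).symm

variable (E : IntermediateField ℚ_[p] (PadicAlgCl p)) [FiniteDimensional ℚ_[p] E]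
  (F : IntermediateField E (PadicAlgCl p)) [FiniteDimensional E F]

open Polynomial IsLocalRing in
/-- An integral lift of a generator of the residue field extension, and an integral lift of its
minimal polynomial. -/
theorem exists_integral_generator_residueField :
    ∃ (h : (integers p E)[X]) (b : integers p F), h.Monic ∧
      h.natDegree = Module.finrank (ResidueField (integers p E)) (ResidueField (integers p F)) ∧
      Irreducible (h.map (algebraMap (integers p E) E)) ∧ aeval b h ∈ maximalIdeal (integers p F) ∧
      IsUnit (aeval b (derivative h)) := by
  obtain ⟨β, hβ⟩ := Field.exists_primitive_element (ResidueField (integers p E))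
    (ResidueField (integers p F))
  have hint : IsIntegral (ResidueField (integers p E)) β := .of_finite _ _
  obtain ⟨h, hh, hdeg, hm⟩ := lifts_and_natDegree_eq_and_monic
    (f := residue (integers p E)) (p := minpoly _ β)
    ((lifts_iff_coeff_lifts _).mpr fun n => residue_surjective _) (minpoly.monic hint)
  obtain ⟨b, rfl⟩ := residue_surjective β
  have hev : ∀ q : (integers p E)[X], residue (integers p F) (aeval b q) =
      aeval (residue (integers p F) b) (q.map (residue (integers p E))) := fun q =>
    map_aeval_eq_aeval_map (φ := residue (integers p E)) (ψ := residue (integers p F)) rfl q b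
  refine ⟨h, b, hm, ?_, ?_, ?_, ?_⟩
  · rw [hdeg]
    exact (Field.primitive_element_iff_minpoly_natDegree_eq _ _).mp hβ
  · rw [← hm.irreducible_iff_irreducible_map_fraction_map]
    refine hm.irreducible_of_irreducible_map (residue (integers p E)) _ ?_
    rw [hh]
    exact minpoly.irreducible hint
  · rw [← residue_eq_zero_iff, hev, hh, minpoly.aeval]
  · rw [← residue_ne_zero_iff_isUnit, hev, ← derivative_map, hh]
    -- The residue fields are finite, so their extension is separable.
    exact (Algebra.IsSeparable.isSeparable _ _).aeval_derivative_ne_zero (minpoly.aeval _ _)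

set_option maxHeartbeats 1000000 in
open Polynomial IsLocalRing in
/-- Hensel's lemma for the integers of an algebraic extension of `ℚ_[p]`. -/
theorem exists_aeval_eq_zero_isUnit_derivative {K L : Type*} [Field K] [Field L]
    [Algebra K (PadicAlgCl p)] [Algebra L (PadicAlgCl p)] [Algebra K L]
    [IsScalarTower K L (PadicAlgCl p)] [Algebra ℚ_[p] L] [IsScalarTower ℚ_[p] L (PadicAlgCl p)]
    {h : (integers p K)[X]} {b : integers p L}
    (hm : h.Monic) (hd : h.natDegree ≠ 0) (hb : aeval b h ∈ maximalIdeal (integers p L))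
    (hu : IsUnit (aeval b (derivative h))) :
    ∃ z : integers p L, aeval z h = 0 ∧ IsUnit (aeval z (derivative h)) := by
  let O := integers p (PadicAlgCl p)
  have : IsScalarTower (integers p K) O (PadicAlgCl p) := .of_algebraMap_eq fun _ => rfl
  have : IsScalarTower (integers p K) (integers p L) O :=
    .of_algebraMap_eq fun x => Subtype.val_injective
      (IsScalarTower.algebraMap_apply K L (PadicAlgCl p) (x : K))
  have : CharZero L := charZero_of_injective_algebraMap (algebraMap ℚ_[p] L).injective
  have : Algebra.IsAlgebraic L (PadicAlgCl p) := Algebra.IsAlgebraic.tower_top (K := ℚ_[p]) L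
  let bO : O := algebraMap (integers p L) O b
  have hval : ∀ (x : O) (q : (integers p K)[X]),
      aeval (x : PadicAlgCl p) q = (aeval x q : O) := fun x q =>
    aeval_algebraMap_apply (PadicAlgCl p) x q
  have hmO : ∀ {x : O}, x ∈ maximalIdeal O ↔ ‖(x : PadicAlgCl p)‖ < 1 :=
    mem_maximalIdeal_integers_iff
  have hbO : aeval bO h ∈ maximalIdeal O := by
    rw [aeval_algebraMap_apply]
    exact hmO.mpr (mem_maximalIdeal_integers_iff.mp hb)
  obtain ⟨z, hz, hzb⟩ : ∃ z : O, aeval z h = 0 ∧ ‖(z : PadicAlgCl p) - bO‖ < 1 := by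
    set c := ‖(aeval bO h : PadicAlgCl p)‖
    have hc : c < 1 := hmO.mp hbO
    have hnd := hm.natDegree_map (algebraMap (integers p K) K)
    -- The radius `c ^ (1/n)`, with `n` the degree of `h`, is below 1: some root in the algebraic
    -- closure reduces to the same residue as `b`.
    obtain ⟨z, hz, hzb⟩ := exists_aeval_eq_zero_norm_sub_le (x := (bO : PadicAlgCl p))
      (r := c ^ ((h.natDegree : ℝ)⁻¹)) (hm.map (algebraMap (integers p K) K)) (by rwa [hnd])
      (Real.rpow_nonneg (norm_nonneg _) _) (by
        rw [hnd, Real.rpow_inv_natCast_pow (norm_nonneg _) hd, aeval_map_algebraMap, hval])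
    have hzb1 : ‖z - bO‖ < 1 := hzb.trans_lt
      (Real.rpow_lt_one (norm_nonneg _) hc (by positivity))
    have hz1 : z ∈ O := by
      rw [← sub_add_cancel z bO]
      exact add_mem (mem_integers_iff.mpr hzb1.le) bO.2
    refine ⟨⟨z, hz1⟩, Subtype.val_injective ?_, hzb1⟩
    rw [← hval, ← aeval_map_algebraMap K]
    exact hz
  have hzbm : z - bO ∈ maximalIdeal O := hmO.mpr hzb
  have hzu : IsUnit (aeval z (derivative h)) := by
    by_contra hn
    have hbu : IsUnit (aeval bO (derivative h)) := by
      rw [aeval_algebraMap_apply]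
      exact hu.map _
    refine (mem_maximalIdeal _).mp ?_ hbu
    rw [← sub_sub_cancel (aeval z (derivative h)) (aeval bO (derivative h))]
    refine sub_mem ((mem_maximalIdeal _).mpr hn) (Ideal.mem_of_dvd _ ?_ hzbm)
    rw [← eval_map_algebraMap, ← eval_map_algebraMap _ bO]
    exact sub_dvd_eval_sub _ _ _
  -- Galois descent replaces completeness: `σ z` is another root of `h` congruent to `b`, hence
  -- equal to `z`.
  obtain ⟨w, hw⟩ : (z : PadicAlgCl p) ∈ Set.range (algebraMap L (PadicAlgCl p)) := by
    have : IsAlgClosure L (PadicAlgCl p) := ⟨inferInstance, inferInstance⟩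
    have : Normal L (PadicAlgCl p) := IsAlgClosure.normal L _
    have : IsGalois L (PadicAlgCl p) := {}
    refine (InfiniteGalois.mem_range_algebraMap_iff_fixed _).mpr fun σ => ?_
    let y : O := ⟨σ z, mem_integers_iff.mpr ((norm_algEquiv σ z).trans_le z.2)⟩
    have hy : aeval y h = 0 := Subtype.val_injective (by
      rw [← hval, ← aeval_map_algebraMap K]
      change aeval (σ (z : PadicAlgCl p)) _ = 0
      rw [← AlgEquiv.restrictScalars_apply K, ← AlgEquiv.coe_toAlgHom, aeval_algHom_apply, aeval_map_algebraMap, hval, hz]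
      exact map_zero σ)
    have hyz : y - z ∈ maximalIdeal O := by
      rw [← sub_sub_sub_cancel_right y z bO]
      refine sub_mem (hmO.mpr ?_) hzbm
      have hσb : σ (bO : PadicAlgCl p) = bO :=
        σ.commutes (b : L)
      have hσz : ‖σ (z : PadicAlgCl p) - bO‖ < 1 := by
        conv_lhs => rw [← hσb]
        rw [← map_sub, norm_algEquiv]
        exact hzb
      exact hσz
    exact congrArg Subtype.val
      (IsLocalRing.eq_of_aeval_eq_zero_of_isUnit_derivative hz hy hzu hyz)
  let zL : integers p L := ⟨w, mem_integers_iff.mpr (hw ▸ z.2)⟩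
  have hzL : algebraMap (integers p L) O zL = z := Subtype.val_injective hw
  have hinj : Function.Injective (algebraMap (integers p L) O) := fun x y hxy =>
    Subtype.val_injective ((algebraMap L (PadicAlgCl p)).injective (congrArg Subtype.val hxy))
  refine ⟨zL, hinj ?_, ?_⟩
  · rw [← aeval_algebraMap_apply, hzL, hz, map_zero]
  · refine isUnit_of_map_unit (algebraMap (integers p L) O) (aeval zL (derivative h)) ?_
    rwa [← aeval_algebraMap_apply, hzL]

-- Irreducibility makes `h` the minimal polynomial of `z`. Euler's element `z ^ (n - 1) / h'(z)` has
-- trace one, and it is integral because `h'(z)` is a unit.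
open IntermediateField Polynomial in
theorem exists_finrank_adjoin_eq_trace_eq_one {K L : Type*} [Field K] [Field L] [CharZero K]
    [Algebra K (PadicAlgCl p)] [Algebra L (PadicAlgCl p)] [Algebra K L]
    [IsScalarTower K L (PadicAlgCl p)] [FiniteDimensional K L] {h : (integers p K)[X]}
    (hm : h.Monic) (hirr : Irreducible (h.map (algebraMap (integers p K) K)))
    {z : integers p L} (hz : aeval z h = 0) (hu : IsUnit (aeval z (derivative h))) :
    Module.finrank K K⟮(z : L)⟯ * Module.finrank K⟮(z : L)⟯ L = Module.finrank K L ∧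
      Module.finrank K K⟮(z : L)⟯ = h.natDegree ∧ ∃ α : K⟮(z : L)⟯,
      ‖algebraMap K⟮(z : L)⟯ (PadicAlgCl p) α‖ ≤ 1 ∧ Algebra.trace K K⟮(z : L)⟯ α = 1 := by
  have hval (q : (integers p K)[X]) :
      aeval (z : L) (q.map (algebraMap (integers p K) K)) = (aeval z q : integers p L) := by
    rw [aeval_map_algebraMap]
    exact aeval_algebraMap_apply L z q
  have hz0 : aeval (z : L) (h.map (algebraMap (integers p K) K)) = 0 := by
    rw [hval, hz]
    rfl
  have hmin : minpoly K (z : L) = h.map (algebraMap (integers p K) K) :=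
    (minpoly.eq_of_irreducible_of_monic hirr hz0 (hm.map _)).symm
  have hint : IsIntegral K (z : L) := .of_finite _ _
  refine ⟨Module.finrank_mul_finrank _ _ _, ?_, ?_⟩
  · rw [adjoin.finrank hint, hmin, hm.natDegree_map]
  · let pb := adjoin.powerBasis hint
    refine ⟨_, ?_, pb.trace_gen_pow_div_aeval_derivative⟩
    obtain ⟨u, hu⟩ := hu
    have hgen : algebraMap K⟮(z : L)⟯ L pb.gen = z := rfl
    have hx : algebraMap K⟮(z : L)⟯ L (pb.gen ^ (pb.dim - 1) /
        aeval pb.gen (derivative (minpoly K pb.gen))) =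
          (z ^ (pb.dim - 1) * (u⁻¹ : (integers p L)ˣ) : integers p L) := by
      rw [map_div₀, map_pow, ← aeval_algebraMap_apply, hgen,
        ← minpoly.algebraMap_eq (algebraMap K⟮(z : L)⟯ L).injective, hgen, hmin, derivative_map,
        hval, ← hu, div_eq_iff]
      · norm_cast
        simp
      · intro h0
        exact u.ne_zero (Subtype.val_injective h0)
    rw [IsScalarTower.algebraMap_apply K⟮(z : L)⟯ L, hx]
    exact mem_integers_iff.mp (Subtype.mem _)

open IntermediateField Polynomial in
/-- There is an intermediate field over which the degree of `F` is at most the ramification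
index, and which has an integral element of trace one. -/
theorem exists_trace_eq_one_finrank_le_ramificationIndex :
    ∃ z : F, Module.finrank E⟮z⟯ F ≤ ramificationIndex E F ∧ ∃ α : E⟮z⟯,
      ‖algebraMap E⟮z⟯ (PadicAlgCl p) α‖ ≤ 1 ∧ Algebra.trace E E⟮z⟯ α = 1 := by
  obtain ⟨h, b, hm, hdeg, hirr, hb, hu⟩ := exists_integral_generator_residueField E F
  have hpos : 0 < h.natDegree := hdeg ▸ Module.finrank_pos
  obtain ⟨z, hz, hzu⟩ := exists_aeval_eq_zero_isUnit_derivative hm hpos.ne' hb hu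
  obtain ⟨h1, hfin, hα⟩ := exists_finrank_adjoin_eq_trace_eq_one hm hirr hz hzu
  refine ⟨z, ?_, hα⟩
  rw [← ramificationIndex_mul_finrank_residueField, ← hdeg, hfin, mul_comm] at h1
  exact (Nat.eq_of_mul_eq_mul_right hpos h1).le


end PadicDisk

/-! ### Invariant disks and minimal ramification -/

namespace PadicDisk
variable {p : ℕ} [Fact p.Prime]

theorem norm_sub_le_max {G : Type*} [SeminormedAddCommGroup G] [IsUltrametricDist G] (x y : G) :
    ‖x - y‖ ≤ max ‖x‖ ‖y‖ := by
  simpa [sub_eq_add_neg] using IsUltrametricDist.norm_add_le_max x (-y)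

theorem norm_natCast_of_not_dvd {m : ℕ} (hm : ¬ p ∣ m) : ‖(m : PadicAlgCl p)‖ = 1 := by
  rw [← map_natCast (algebraMap ℚ_[p] (PadicAlgCl p)), PadicAlgCl.norm_extends,
    Padic.norm_natCast_eq_one_iff]
  exact (Fact.out : p.Prime).coprime_iff_not_dvd.mpr hm

/-- Every point of an ultrametric disk is a center. Measuring by a second point `b` of `D`, not by
the radius, treats open and closed disks alike. -/
theorem IsDisk.mem_of_norm_sub_le {D : Set ℂ_[p]} (hD : IsDisk D) {a b c : ℂ_[p]} (ha : a ∈ D)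
    (hb : b ∈ D) (hc : ‖c - a‖ ≤ ‖b - a‖) : c ∈ D := by
  obtain ⟨o, r, h⟩ := hD
  have hba : ‖b - a‖ ≤ max ‖b - o‖ ‖a - o‖ := by
    rw [← sub_sub_sub_cancel_right b a o]
    exact norm_sub_le_max _ _
  have hco : ‖c - o‖ ≤ max ‖b - o‖ ‖a - o‖ := by
    rw [← sub_add_sub_cancel c a o]
    exact (IsUltrametricDist.norm_add_le_max _ _).trans
      (max_le (hc.trans hba) (le_max_right _ _))
  rcases h with rfl | rfl
  · exact hco.trans (max_le hb ha)
  · exact hco.trans_lt (max_lt hb ha)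

variable {E : IntermediateField ℚ_[p] (PadicAlgCl p)} {D : Set ℂ_[p]}

theorem IsDefinedOver.algEquiv_mem (hDE : IsDefinedOver E D) (σ : PadicAlgCl p ≃ₐ[E] PadicAlgCl p)
    {x : PadicAlgCl p} (hx : (x : ℂ_[p]) ∈ D) : ((σ x : PadicAlgCl p) : ℂ_[p]) ∈ D := by
  rw [← hDE σ]
  exact ⟨x, hx, UniformSpace.Completion.mapRingHom_coe (continuous_gal E σ) x⟩

/-- A disk defined over `E` contains a closed disk, with the same center, that contains all the
conjugates of its center. -/
theorem IsDisk.exists_radius (hD : IsDisk D) (hDE : IsDefinedOver E D) {x : PadicAlgCl p}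
    (hx : (x : ℂ_[p]) ∈ D) : ∃ r : ℝ, (∀ σ : PadicAlgCl p ≃ₐ[E] PadicAlgCl p, ‖σ x - x‖ ≤ r) ∧
      ∀ y : PadicAlgCl p, ‖y - x‖ ≤ r → (y : ℂ_[p]) ∈ D := by
  have hint : IsIntegral E x := (Algebra.IsAlgebraic.isAlgebraic x).isIntegral
  have hfin : (Set.range fun σ : PadicAlgCl p ≃ₐ[E] PadicAlgCl p => σ x).Finite := by
    refine ((minpoly E x).rootSet_finite (PadicAlgCl p)).subset ?_
    rintro _ ⟨σ, rfl⟩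
    refine (Polynomial.mem_rootSet_of_ne (minpoly.ne_zero hint)).mpr ?_
    have h := Polynomial.aeval_algHom_apply (σ : PadicAlgCl p →ₐ[E] PadicAlgCl p) x (minpoly E x)
    rw [minpoly.aeval, map_zero] at h
    exact h
  obtain ⟨_, ⟨τ, rfl⟩, hτ⟩ := Set.exists_max_image _ (fun z => ‖z - x‖) hfin
    (Set.range_nonempty _)
  refine ⟨‖τ x - x‖, fun σ => hτ _ ⟨σ, rfl⟩, fun y hy => ?_⟩
  refine hD.mem_of_norm_sub_le hx (hDE.algEquiv_mem τ hx) ?_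
  rwa [← UniformSpace.Completion.coe_sub, ← UniformSpace.Completion.coe_sub,
    PadicComplex.norm_extends, PadicComplex.norm_extends]

theorem IsDisk.exists_coe_mem (hD : IsDisk D) (hn : D.Nontrivial) :
    ∃ x : PadicAlgCl p, (x : ℂ_[p]) ∈ D := by
  obtain ⟨a, ha, b, hb, hab⟩ := hn
  obtain ⟨x, hx⟩ := (UniformSpace.Completion.denseRange_coe (α := PadicAlgCl p)).exists_dist_lt a
    (norm_pos_iff.mpr (sub_ne_zero.mpr hab.symm))
  refine ⟨x, hD.mem_of_norm_sub_le ha hb ?_⟩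
  rw [← dist_eq_norm, dist_comm]
  exact hx.le

variable (E) in
open IntermediateField in
theorem exists_isLeast_ramificationIndices (hD : IsDisk D) (hn : D.Nontrivial) :
    ∃ e : ℕ, IsLeast (ramificationIndices E D) e := by
  obtain ⟨x, hx⟩ := hD.exists_coe_mem hn
  have hne : (ramificationIndices E D).Nonempty :=
    ⟨_, E⟮x⟯, adjoin.finiteDimensional (Algebra.IsAlgebraic.isAlgebraic x).isIntegral, rfl, x,
      mem_adjoin_simple_self E x, hx⟩
  exact ⟨_, Nat.sInf_mem hne, fun _ h => Nat.sInf_le h⟩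

variable [FiniteDimensional ℚ_[p] E]

open IntermediateField in
/-- If `F` has a point in an invariant disk, then there is a point in this disk whose degree is at
most a power of `p` that is at most the ramification index of `F`. -/
theorem exists_norm_sub_le_natDegree_minpoly_le_ramificationIndex
    (F : IntermediateField E (PadicAlgCl p)) [FiniteDimensional E F] (x : F) {r : ℝ}
    (hr : ∀ σ : PadicAlgCl p ≃ₐ[E] PadicAlgCl p, ‖σ x - x‖ ≤ r) :
    ∃ (w : PadicAlgCl p) (t : ℕ), ‖w - x‖ ≤ r ∧ (minpoly E w).natDegree ≤ p ^ t ∧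
      p ^ t ≤ ramificationIndex E F := by
  obtain ⟨z, hz, α, hα, htr⟩ := exists_trace_eq_one_finrank_le_ramificationIndex E F
  have : IsScalarTower ℚ_[p] E⟮z⟯ (PadicAlgCl p) := .of_algebraMap_eq fun _ => rfl
  have : IsScalarTower E E⟮z⟯ (PadicAlgCl p) := .of_algebraMap_eq fun _ => rfl
  have : Algebra.IsAlgebraic E⟮z⟯ (PadicAlgCl p) := Algebra.IsAlgebraic.tower_top (K := E) _
  obtain ⟨y, t, hyx, hy, hyt⟩ := exists_norm_sub_le_natDegree_minpoly_le_prime_pow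
    (K := E⟮z⟯) norm_algEquiv p (fun _ => norm_natCast_of_not_dvd) (x := (x : PadicAlgCl p))
    (fun σ => hr (σ.restrictScalars E))
  obtain ⟨w, hwy, hw⟩ := exists_norm_sub_le_natDegree_minpoly_le (K := E) norm_algEquiv hα htr
    (x := y) (r := r) fun σ => by
      -- The new point `y` inherits the bound `r` on its conjugates over `E`, so the averaging
      -- applies again.
      have h : σ y - y = σ (y - x) + ((σ x - x) - (y - x)) := by rw [map_sub]; ring
      rw [h]
      refine (IsUltrametricDist.norm_add_le_max _ _).trans (max_le ?_ ?_)
      · rwa [norm_algEquiv]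
      · exact (norm_sub_le_max _ _).trans (max_le (hr σ) hyx)
  refine ⟨w, t, ?_, hw.trans hy, hyt.trans (le_trans ?_ hz)⟩
  · rw [← sub_add_sub_cancel w y]
    exact (IsUltrametricDist.norm_add_le_max _ _).trans (max_le hwy hyx)
  · have h := minpoly.natDegree_le (A := E⟮z⟯) x
    rwa [← minpoly.algebraMap_eq (algebraMap F (PadicAlgCl p)).injective x] at h

open IntermediateField in
theorem exists_isTotallyRamified_of_isLeast (hD : IsDisk D) (hDE : IsDefinedOver E D) {e : ℕ}
    (he : IsLeast (ramificationIndices E D) e) :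
    ∃ s : ℕ, e = p ^ s ∧ ∃ F : IntermediateField E (PadicAlgCl p),
      IsTotallyRamified E F ∧ Module.finrank E F = p ^ s ∧ Meets E F D := by
  obtain ⟨⟨F, _, rfl, x, hxF, hxD⟩, hmin⟩ := he
  obtain ⟨r, hr, hrD⟩ := hD.exists_radius hDE hxD
  obtain ⟨w, t, hwx, hwt, ht⟩ :=
    exists_norm_sub_le_natDegree_minpoly_le_ramificationIndex F ⟨x, hxF⟩ hr
  have hint : IsIntegral E w := (Algebra.IsAlgebraic.isAlgebraic w).isIntegral
  have : FiniteDimensional E E⟮w⟯ := adjoin.finiteDimensional hint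
  have hM : Meets E E⟮w⟯ D := ⟨w, mem_adjoin_simple_self E w, hrD w hwx⟩
  -- Together with `ht`, this closes a cycle of inequalities, so every term equals `p ^ t`.
  have h1 : ramificationIndex E F ≤ ramificationIndex E E⟮w⟯ := hmin ⟨E⟮w⟯, this, rfl, hM⟩
  have h2 := ramificationIndex_le_finrank E E⟮w⟯
  have h3 : Module.finrank E E⟮w⟯ ≤ p ^ t := by rwa [adjoin.finrank hint]
  exact ⟨t, by omega, E⟮w⟯, ⟨this, by omega⟩, by omega, hM⟩

end PadicDisk

theorem mainTheorem11 (E : IntermediateField ℚ_[2] (PadicAlgCl 2)) [FiniteDimensional ℚ_[2] E]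
    (D : Set ℂ_[2]) (hD : PadicDisk.IsDisk D) (hDE : PadicDisk.IsDefinedOver E D) :
    (D.Nontrivial → ∃ e : ℕ, IsLeast (PadicDisk.ramificationIndices E D) e) ∧
    ∀ e : ℕ, IsLeast (PadicDisk.ramificationIndices E D) e →
      ∃ s : ℕ, e = 2 ^ s ∧
        ∃ F : IntermediateField E (PadicAlgCl 2),
          PadicDisk.IsTotallyRamified E F ∧ Module.finrank E F = 2 ^ s ∧
            PadicDisk.Meets E F D :=
  ⟨PadicDisk.exists_isLeast_ramificationIndices E hD,
    fun _ he => PadicDisk.exists_isTotallyRamified_of_isLeast hD hDE he⟩
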